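/- Let $d\ge 2$ be an integer. A Coxeter matrix over a finite set $S$ is a matrix $M=(m_{s,t})_{s,t\in S}$ with entries in $\mathbb N\cup\{\infty\}$ such that $m_{s,s}=1$ for all $s \in S$ and $m_{s,t}=m_{t,s}\ge 2$ for all $s\ne t$. Its Artin group is $$A[M]=\langle S \mid \underbrace{sts\cdots}_{m_{s,t}}=\underbrace{tst\cdots}_{m_{s,t}}\ \text{ for all } s,t\in S \text{ with } s\neq t \text{ and } m_{s,t}\ne\infty\rangle .$$ Two Coxeter matrices $M=(m_{s,t})_{s,t\in S}$ and $N=(n_{x,y})_{x,y\in T}$ are isomorphic if there is a bijection $e:S\to T$ with $n_{e(s),e(t)}=m_{s,t}$ for all $s,t\in S$. Let $\mathcal E(1,d)$ be the set of Coxeter matrices (over arbitrary finite sets) all of whose off-diagonal entries lie in $\{2,\infty\}\cup\{2d^r\mid r\ge 1\}$; all such matrices are even, i.e. their off-diagonal entries are even or $\infty$. Then the family of Artin groups $\{A[M] \mid M\in\mathcal E(1,d)\}$ is rigid: for all $M,N\in\mathcal E(1,d)$, the groups $A[M]$ and $A[N]$ are isomorphic if and only if the Coxeter matrices $M$ and $N$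 are isomorphic. -/

import Mathlib

universe u v

/-- The alternating word `s t s ⋯` of length `m`, starting with `s`, evaluated in a monoid. -/
def altWord {G : Type u} [Monoid G] (s t : G) : ℕ → G
  | 0 => 1
  | m + 1 => s * altWord t s m

namespace CoxeterMatrix

/-- The defining relators of the Artin group of `M`, one for each pair `s ≠ t` whose entry is
finite. As everywhere in Mathlib, the entry `∞` of a Coxeter matrix is encoded by `0`. -/
def artinRels {S : Type u} (M : CoxeterMatrix S) : Set (FreeGroup S) :=
  {w | ∃ s t : S, s ≠ t ∧ M s t ≠ 0 ∧
    w = altWord (FreeGroup.of s) (FreeGroup.of t) (M s t) *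
      (altWord (FreeGroup.of t) (FreeGroup.of s) (M s t))⁻¹}

/-- The Artin group `A[M]`: generators `S`, and the relation `s t s ⋯ = t s t ⋯`, with `m_{s,t}`
letters on each side, for all `s ≠ t` with `m_{s,t} ≠ ∞`. -/
abbrev ArtinGroup {S : Type u} (M : CoxeterMatrix S) : Type u :=
  PresentedGroup M.artinRels

/-- Isomorphism of Coxeter matrices: a bijection of the index sets that preserves the entries. -/
def Iso {S : Type u} {T : Type v} (M : CoxeterMatrix S) (N : CoxeterMatrix T) : Prop :=
  ∃ e : S ≃ T, ∀ s t : S, N (e s) (e t) = M s t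

/-- Every off-diagonal entry is even (`∞`, encoded by `0`, counts as even). -/
def IsEven {S : Type u} (M : CoxeterMatrix S) : Prop :=
  ∀ s t : S, s ≠ t → Even (M s t)

/-- The family `𝓔(c,d)`: even Coxeter matrices whose off-diagonal entries lie in
`{2c, ∞} ∪ {2d^r | r ≥ 1}`. -/
def EvenFamily (c d : ℕ) (S : Type u) (M : CoxeterMatrix S) : Prop :=
  M.IsEven ∧ ∀ s t : S, s ≠ t →
    M s t = 2 * c ∨ M s t = 0 ∨ ∃ r : ℕ, 1 ≤ r ∧ M s t = 2 * d ^ r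

/-- The family of Artin groups attached to a family `𝓜` of Coxeter matrices (over finite index
sets) is rigid: the Artin groups of two members are isomorphic if and only if the matrices are. -/
def ArtinRigid (𝓜 : ∀ S : Type u, CoxeterMatrix S → Prop) : Prop :=
  ∀ (S T : Type u) [Finite S] [Finite T] (M : CoxeterMatrix S) (N : CoxeterMatrix T),
    𝓜 S M → 𝓜 T N → (Nonempty (M.ArtinGroup ≃* N.ArtinGroup) ↔ M.Iso N)

end CoxeterMatrix

/-!
The exponent sums of the generators identify the abelianization of an even Artin group with `ℤ^S`,
so mutually inverse isomorphisms between `A[M]` and `A[N]` induce mutually inverse integer matrices.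
Suppose `n_{t,y} = 2k`. Sending the generators `t` and `y` of `A[N]` to the elementary generators of
the Heisenberg group over `ℤ/k`, and all others to `1`, shows that `n_{t,y}` divides `m_{s,x}` times
the `2 × 2` minor in rows `t, y` and columns `s, x`. Modulo a prime `p`, such a minor therefore
vanishes unless `v_p(n_{t,y}) ≤ v_p(m_{s,x})`. Linear algebra over `ℤ/p` turns this into a bijection
of the generators that preserves `v_p` of the labels. For a prime factor `p` of `d`, a label in
`{0} ∪ {2 d^r}` is determined by its `p`-adic valuation.
-/

/-! ### Minors of mutually inverse matrices -/

section Minors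

open Matrix

variable {S T R Λ : Type*} [CommRing R]

/-- The `2 × 2` minor of `Φ` in rows `t, y` and columns `s, x`. Coinciding rows or columns are
allowed, and then the minor vanishes. -/
def minor₂ (Φ : Matrix T S R) (t y : T) (s x : S) : R :=
  Φ t s * Φ y x - Φ t x * Φ y s

lemma minor₂_transpose (Φ : Matrix T S R) (t y : T) (s x : S) :
    minor₂ Φᵀ s x t y = minor₂ Φ t y s x := by
  simp only [minor₂, transpose_apply]
  ring

lemma rows_ne_of_minor₂_ne_zero {Φ : Matrix T S R} {t y : T} {s x : S}
    (h : minor₂ Φ t y s x ≠ 0) : t ≠ y := by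
  rintro rfl
  exact h (by rw [minor₂]; ring)

lemma columns_ne_of_minor₂_ne_zero {Φ : Matrix T S R} {t y : T} {s x : S}
    (h : minor₂ Φ t y s x ≠ 0) : s ≠ x :=
  rows_ne_of_minor₂_ne_zero (minor₂_transpose Φ t y s x ▸ h)

lemma minor₂_one_eq_zero [DecidableEq S] {t y s x : S} (h : s(t, y) ≠ s(s, x)) :
    minor₂ (1 : Matrix S S R) t y s x = 0 := by
  simp only [minor₂, one_apply, ite_zero_mul_ite_zero]
  rw [if_neg fun e => h (by rw [e.1, e.2]), if_neg fun e => h (by rw [e.1, e.2, Sym2.eq_swap]),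
    sub_zero]

lemma minor₂_map {R' : Type*} [CommRing R'] (f : R →+* R') (Φ : Matrix T S R) (t y : T) (s x : S) :
    minor₂ (Φ.map f) t y s x = f (minor₂ Φ t y s x) := by
  simp only [minor₂, map_apply, map_sub, map_mul]

lemma exists_minor₂_ne_zero [Nontrivial R] [Fintype T] [DecidableEq S] {Φ : Matrix T S R}
    {Ψ : Matrix S T R} (h : Ψ * Φ = 1) {s x : S} (hsx : s ≠ x) :
    ∃ t y, Ψ s t ≠ 0 ∧ Ψ x y ≠ 0 ∧ minor₂ Φ t y s x ≠ 0 := by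
  have cauchyBinet : ∑ t, ∑ y, Ψ s t * Ψ x y * minor₂ Φ t y s x = 1 := by
    calc
      _ = (Ψ * Φ) s s * (Ψ * Φ) x x - (Ψ * Φ) s x * (Ψ * Φ) x s := by
        simp only [mul_apply, Finset.sum_mul_sum, ← Finset.sum_sub_distrib, minor₂]
        exact Finset.sum_congr rfl fun t _ => Finset.sum_congr rfl fun y _ => by ring
      _ = 1 := by simp only [h, one_apply_eq, one_apply_ne hsx, mul_one, zero_mul, sub_zero]
  obtain ⟨t, -, ht⟩ := Finset.exists_ne_zero_of_sum_ne_zero (cauchyBinet.trans_ne one_ne_zero)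
  obtain ⟨y, -, hy⟩ := Finset.exists_ne_zero_of_sum_ne_zero ht
  have hΨ := left_ne_zero_of_mul hy
  exact ⟨t, y, left_ne_zero_of_mul hΨ, right_ne_zero_of_mul hΨ, right_ne_zero_of_mul hy⟩

lemma sum_minor₂_mul_minor₂ [Fintype S] [DecidableEq T] {Φ : Matrix T S R} {Ψ : Matrix S T R}
    (h : Φ * Ψ = 1) {t t' x : T} (htt' : t ≠ t') (hxt : x ≠ t) (hxt' : x ≠ t') (s : S) :
    ∑ u, minor₂ Φ t x s u * minor₂ Ψ s u t' x = Φ t s * Ψ s t' := by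
  calc
    _ = Φ t s * Ψ s t' * (Φ * Ψ) x x - Φ x s * Ψ s t' * (Φ * Ψ) t x
        - Φ t s * Ψ s x * (Φ * Ψ) x t' + Φ x s * Ψ s x * (Φ * Ψ) t t' := by
      simp only [mul_apply, Finset.mul_sum, ← Finset.sum_sub_distrib, ← Finset.sum_add_distrib,
        minor₂]
      exact Finset.sum_congr rfl fun u _ => by ring
    _ = _ := by
      simp only [h, one_apply_eq, one_apply_ne hxt.symm, one_apply_ne hxt', one_apply_ne htt']
      ring

lemma map_mul_map_eq_one {R' : Type*} [CommRing R'] [Fintype S] [DecidableEq T] {Φ : Matrix T S R}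
    {Ψ : Matrix S T R} (h : Φ * Ψ = 1) (f : R →+* R') : Φ.map f * Ψ.map f = 1 := by
  rw [← Matrix.map_mul, h, Matrix.map_one f (map_zero f) (map_one f)]

lemma exists_ne_zero_and_ne_zero_of_mul_eq_one [Nontrivial R] [Fintype T] [DecidableEq S]
    {Φ : Matrix T S R} {Ψ : Matrix S T R} (h : Ψ * Φ = 1) (s : S) :
    ∃ t, Φ t s ≠ 0 ∧ Ψ s t ≠ 0 := by
  have hsum : ∑ t, Ψ s t * Φ t s ≠ 0 := by
    rw [← mul_apply, h, one_apply_eq]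
    exact one_ne_zero
  obtain ⟨t, -, ht⟩ := Finset.exists_ne_zero_of_sum_ne_zero hsum
  exact ⟨t, right_ne_zero_of_mul ht, left_ne_zero_of_mul ht⟩

lemma toBlock_mul_toBlock_eq_one [Fintype S] [DecidableEq T] {Φ : Matrix T S R} {Ψ : Matrix S T R}
    (h : Φ * Ψ = 1) (q : T → Prop) (p : S → Prop) [DecidablePred p]
    (hp : ∀ t s t', q t → q t' → Φ t s ≠ 0 → Ψ s t' ≠ 0 → p s) :
    Φ.toBlock q p * Ψ.toBlock p q = 1 := by
  have hzero : Φ.toBlock q (¬ p ·) * Ψ.toBlock (¬ p ·) q = 0 := by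
    ext t t'
    rw [mul_apply]
    refine Finset.sum_eq_zero fun s _ => ?_
    by_contra hs
    exact s.2 (hp t s t' t.2 t'.2 (left_ne_zero_of_mul hs) (right_ne_zero_of_mul hs))
  rw [← toBlock_one_self q, ← h, toBlock_mul_eq_add q p q, hzero, add_zero]

theorem exists_equiv_of_isPreorder [Nontrivial R] [Fintype S] [Fintype T] [DecidableEq S]
    [DecidableEq T] {Φ : Matrix T S R} {Ψ : Matrix S T R} (hΦΨ : Φ * Ψ = 1) (hΨΦ : Ψ * Φ = 1)
    (r : T → T → Prop) [IsPreorder T r] (hr : ∀ t s t', Φ t s ≠ 0 → Ψ s t' ≠ 0 → r t t') :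
    ∃ e : S ≃ T, ∀ s, (∀ t, Φ t s ≠ 0 → r t (e s)) ∧ ∀ t, Ψ s t ≠ 0 → r (e s) t := by
  classical
  choose c hΦc hΨc using exists_ne_zero_and_ne_zero_of_mul_eq_one hΨΦ
  let cls : T → Antisymmetrization T r := toAntisymmetrization r
  have cls_eq_iff {t t' : T} : cls t = cls t' ↔ AntisymmRel r t t' := Quotient.eq
  -- The two matrices stay mutually inverse when restricted to a class, so these blocks are square.
  have card_fiber (z) : Fintype.card {s // cls (c s) = z} = Fintype.card {t // cls t = z} := by
    refine square_of_invertible (Ψ.toBlock _ _) (Φ.toBlock _ _)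
      (toBlock_mul_toBlock_eq_one hΨΦ _ _ ?_) (toBlock_mul_toBlock_eq_one hΦΨ _ _ ?_)
    · rintro s t s' rfl hs' hΨ hΦ
      exact cls_eq_iff.2 ⟨_root_.trans (hr _ _ _ hΦ (hΨc s')) (cls_eq_iff.1 hs').1,
        hr _ _ _ (hΦc s) hΨ⟩
    · rintro t s t' rfl ht' hΦ hΨ
      exact cls_eq_iff.2 ⟨_root_.trans (hr _ _ _ (hΦc s) hΨ) (cls_eq_iff.1 ht').1,
        hr _ _ _ hΦ (hΨc s)⟩
  let e : S ≃ T := Equiv.ofFiberEquiv fun z => Fintype.equivOfCardEq (card_fiber z)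
  have he (s : S) : AntisymmRel r (e s) (c s) := cls_eq_iff.1 (Equiv.ofFiberEquiv_map _ s)
  exact ⟨e, fun s => ⟨fun t hΦ => _root_.trans (hr _ _ _ hΦ (hΨc s)) (he s).2,
    fun t hΨ => _root_.trans (he s).1 (hr _ _ _ (hΦc s) hΨ)⟩⟩

/-! ### Matrices compatible with edge labels -/

/-- The preorder on the vertices of a complete graph with edge labels `b`: `t` lies below `u` if
each edge at `t` has a label at most that of the corresponding edge at `u`. -/
def LabelLE [LE Λ] (b : Sym2 T → Λ) (t u : T) : Prop :=
  ∀ x, x ≠ t → x ≠ u → b s(t, x) ≤ b s(u, x)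

instance [Preorder Λ] (b : Sym2 T → Λ) : IsPreorder T (LabelLE b) where
  refl _ _ _ _ := le_rfl
  trans t u v htu huv x hxt hxv := by
    rcases eq_or_ne x u with rfl | hxu
    · rcases eq_or_ne t v with rfl | htv
      · exact le_rfl
      · calc
          b s(t, x) = b s(x, t) := by rw [Sym2.eq_swap]
          _ ≤ b s(v, t) := huv t hxt.symm htv
          _ = b s(t, v) := by rw [Sym2.eq_swap]
          _ ≤ b s(x, v) := htu v htv.symm hxv.symm
          _ = b s(v, x) := by rw [Sym2.eq_swap]
    · exact (htu x hxt hxu).trans (huv x hxu hxv)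

lemma LabelLE.label_le [Preorder Λ] {b : Sym2 T → Λ} {t y u v : T} (htu : LabelLE b t u)
    (hyv : LabelLE b y v) (hty : t ≠ y) (huv : u ≠ v) : b s(t, y) ≤ b s(u, v) := by
  rcases eq_or_ne t v with rfl | htv
  · rw [Sym2.eq_swap]
    exact _root_.trans hyv htu t hty huv.symm
  · calc
      b s(t, y) = b s(y, t) := by rw [Sym2.eq_swap]
      _ ≤ b s(v, t) := hyv t hty htv
      _ = b s(t, v) := by rw [Sym2.eq_swap]
      _ ≤ b s(u, v) := htu v htv.symm huv.symm

/-- A matrix is compatible with labels `b` of the pairs of rows and `a` of the pairs of columns if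
a `2 × 2` minor can be nonzero only where the row label is at most the column label. -/
def LabelCompatible [LE Λ] (b : Sym2 T → Λ) (a : Sym2 S → Λ) (Φ : Matrix T S R) : Prop :=
  ∀ t y s x, minor₂ Φ t y s x ≠ 0 → b s(t, y) ≤ a s(s, x)

lemma labelLE_of_ne_zero [NoZeroDivisors R] [Preorder Λ] [Fintype S] [DecidableEq T]
    {b : Sym2 T → Λ} {a : Sym2 S → Λ} {Φ : Matrix T S R} {Ψ : Matrix S T R} (hΦΨ : Φ * Ψ = 1)
    (hΦ : LabelCompatible b a Φ) (hΨ : LabelCompatible a b Ψ) {t t' : T} {s : S}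
    (h : Φ t s ≠ 0) (h' : Ψ s t' ≠ 0) : LabelLE b t t' := by
  intro x hxt hxt'
  rcases eq_or_ne t t' with rfl | htt'
  · exact le_rfl
  have hsum := (sum_minor₂_mul_minor₂ hΦΨ htt' hxt hxt' s).trans_ne (mul_ne_zero h h')
  obtain ⟨u, -, hu⟩ := Finset.exists_ne_zero_of_sum_ne_zero hsum
  exact (hΦ t x s u (left_ne_zero_of_mul hu)).trans (hΨ s u t' x (right_ne_zero_of_mul hu))

theorem exists_equiv_label_eq [IsDomain R] [PartialOrder Λ] [Fintype S] [Fintype T]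
    [DecidableEq S] [DecidableEq T] {b : Sym2 T → Λ} {a : Sym2 S → Λ} {Φ : Matrix T S R}
    {Ψ : Matrix S T R} (hΦΨ : Φ * Ψ = 1) (hΨΦ : Ψ * Φ = 1)
    (hΦ : LabelCompatible b a Φ) (hΨ : LabelCompatible a b Ψ) :
    ∃ e : S ≃ T, ∀ s x, s ≠ x → b s(e s, e x) = a s(s, x) := by
  obtain ⟨e, he⟩ := exists_equiv_of_isPreorder hΦΨ hΨΦ (LabelLE b) fun _ _ _ =>
    labelLE_of_ne_zero hΦΨ hΦ hΨ
  refine ⟨e, fun s x hsx => le_antisymm ?_ ?_⟩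
  · obtain ⟨t, y, ht, hy, hminor⟩ := exists_minor₂_ne_zero hΨΦ hsx
    calc
      b s(e s, e x) ≤ b s(t, y) := ((he s).2 t ht).label_le ((he x).2 y hy)
        (e.injective.ne hsx) (rows_ne_of_minor₂_ne_zero hminor)
      _ ≤ a s(s, x) := hΦ t y s x hminor
  · have hΦΨ_transpose : Φᵀ * Ψᵀ = 1 := by rw [← transpose_mul, hΨΦ, transpose_one]
    obtain ⟨t, y, ht, hy, hminor⟩ := exists_minor₂_ne_zero hΦΨ_transpose hsx
    rw [minor₂_transpose] at hminor
    calc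
      a s(s, x) ≤ b s(t, y) := hΨ s x t y hminor
      _ ≤ b s(e s, e x) := ((he s).1 t ht).label_le ((he x).1 y hy)
        (columns_ne_of_minor₂_ne_zero hminor) (e.injective.ne hsx)

end Minors

/-! ### Alternating words in the Heisenberg group -/

lemma altWord_two_mul {G : Type*} [Monoid G] (s t : G) (n : ℕ) :
    altWord s t (2 * n) = (s * t) ^ n := by
  induction n with
  | zero => rw [mul_zero, pow_zero, altWord]
  | succ n ih => rw [Nat.mul_succ, altWord, altWord, ih, pow_succ', mul_assoc]

lemma altWord_swap_of_even {G : Type*} [CommMonoid G] (s t : G) {n : ℕ} (hn : Even n) :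
    altWord s t n = altWord t s n := by
  obtain ⟨k, rfl⟩ := hn.two_dvd
  rw [altWord_two_mul, altWord_two_mul, mul_comm]

lemma map_altWord {G H F : Type*} [Monoid G] [Monoid H] [FunLike F G H] [MonoidHomClass F G H]
    (f : F) (s t : G) (n : ℕ) : f (altWord s t n) = altWord (f s) (f t) n := by
  induction n generalizing s t with
  | zero => exact map_one f
  | succ n ih => rw [altWord, altWord, map_mul, ih]

/-- The Heisenberg group over `R`: upper unitriangular `3 × 3` matrices, with `x` and `y` on the
superdiagonal and `z` in the corner. -/
@[ext]
structure Heisenberg (R : Type*) where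
  x : R
  y : R
  z : R

namespace Heisenberg

variable {R : Type*} [CommRing R]

instance : Mul (Heisenberg R) := ⟨fun g h => ⟨g.x + h.x, g.y + h.y, g.z + h.z + g.x * h.y⟩⟩

instance : One (Heisenberg R) := ⟨⟨0, 0, 0⟩⟩

instance : Inv (Heisenberg R) := ⟨fun g => ⟨-g.x, -g.y, -g.z + g.x * g.y⟩⟩

lemma mul_def (g h : Heisenberg R) :
    g * h = ⟨g.x + h.x, g.y + h.y, g.z + h.z + g.x * h.y⟩ := rfl

lemma one_def : (1 : Heisenberg R) = ⟨0, 0, 0⟩ := rfl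

lemma inv_def (g : Heisenberg R) : g⁻¹ = ⟨-g.x, -g.y, -g.z + g.x * g.y⟩ := rfl

instance : Group (Heisenberg R) :=
  Group.ofLeftAxioms
    (fun g h k => by
      simp only [mul_def]
      ext <;> ring)
    (fun g => by
      simp only [mul_def, one_def]
      ext <;> ring)
    (fun g => by
      simp only [mul_def, one_def, inv_def]
      ext <;> ring)

/-- The projection of the Heisenberg group to its first superdiagonal coordinate. -/
def xHom : Heisenberg R →* Multiplicative R where
  toFun g := Multiplicative.ofAdd g.x
  map_one' := rfl
  map_mul' _ _ := rfl

/-- The projection of the Heisenberg group to its second superdiagonal coordinate. -/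
def yHom : Heisenberg R →* Multiplicative R where
  toFun g := Multiplicative.ofAdd g.y
  map_one' := rfl
  map_mul' _ _ := rfl

lemma mk_zero_zero_pow (c : R) (n : ℕ) : (⟨0, 0, c⟩ : Heisenberg R) ^ n = ⟨0, 0, n * c⟩ := by
  induction n with
  | zero => rw [pow_zero, Nat.cast_zero, zero_mul, one_def]
  | succ n ih =>
    rw [pow_succ, ih, mul_def]
    ext <;> push_cast <;> ring

lemma mul_eq_mul_mul_commutator (g h : Heisenberg R) :
    g * h = h * g * ⟨0, 0, g.x * h.y - h.x * g.y⟩ := by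
  simp only [mul_def]
  ext <;> ring

lemma commute_mk_zero_zero (g : Heisenberg R) (c : R) : Commute g ⟨0, 0, c⟩ := by
  simp only [commute_iff_eq, mul_def]
  ext <;> ring

lemma altWord_swap_iff (g h : Heisenberg R) (n : ℕ) :
    altWord g h (2 * n) = altWord h g (2 * n) ↔ (n : R) * (g.x * h.y - h.x * g.y) = 0 := by
  rw [altWord_two_mul, altWord_two_mul, mul_eq_mul_mul_commutator g h,
    (commute_mk_zero_zero _ _).mul_pow, mul_eq_left, mk_zero_zero_pow, one_def,
    Heisenberg.mk.injEq]
  simp only [true_and]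

end Heisenberg

/-! ### Homomorphisms between Artin groups -/

namespace ArtinGroup

open CoxeterMatrix PresentedGroup

variable {S T : Type*} {M : CoxeterMatrix S} {N : CoxeterMatrix T}

lemma altWord_of (M : CoxeterMatrix S) (s t : S) :
    altWord (of s : M.ArtinGroup) (of t) (M s t) = altWord (of t) (of s) (M s t) := by
  rcases eq_or_ne s t with rfl | hst
  · rfl
  rcases eq_or_ne (M s t) 0 with h | h
  · rw [h, altWord, altWord]
  · have hrel := one_of_mem (rels := M.artinRels) ⟨s, t, hst, h, rfl⟩
    rwa [map_mul, map_inv, mul_inv_eq_one, map_altWord, map_altWord] at hrel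

/-- The homomorphism from an Artin group determined by images of the generators that satisfy the
braid relations. -/
def lift {G : Type*} [Group G] (f : S → G)
    (hf : ∀ s t, altWord (f s) (f t) (M s t) = altWord (f t) (f s) (M s t)) :
    M.ArtinGroup →* G :=
  toGroup (f := f) <| by
    rintro _ ⟨s, t, -, -, rfl⟩
    rw [map_mul, map_inv, mul_inv_eq_one, map_altWord, map_altWord, FreeGroup.lift_apply_of,
      FreeGroup.lift_apply_of, hf]

@[simp]
lemma lift_of {G : Type*} [Group G] (f : S → G)
    (hf : ∀ s t, altWord (f s) (f t) (M s t) = altWord (f t) (f s) (M s t)) (s : S) :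
    lift f hf (of s) = f s :=
  toGroup.of _

/-- The homomorphism of Artin groups induced by a label-preserving map of generators. -/
def map (e : S → T) (he : ∀ s t, N (e s) (e t) = M s t) : M.ArtinGroup →* N.ArtinGroup :=
  lift (fun s => of (e s)) fun s t => he s t ▸ altWord_of N (e s) (e t)

@[simp]
lemma map_of (e : S → T) (he : ∀ s t, N (e s) (e t) = M s t) (s : S) :
    map e he (of s) = of (e s) :=
  lift_of _ _ s

lemma nonempty_mulEquiv_of_iso (h : M.Iso N) : Nonempty (M.ArtinGroup ≃* N.ArtinGroup) := by
  obtain ⟨e, he⟩ := h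
  have he_symm (t y : T) : M (e.symm t) (e.symm y) = N t y := by
    rw [← he, e.apply_symm_apply, e.apply_symm_apply]
  refine ⟨MonoidHom.toMulEquiv (map e he) (map e.symm he_symm) ?_ ?_⟩ <;>
  · ext
    simp

/-- The exponent sum of the generator `t`. -/
def exponent [DecidableEq S] (hM : M.IsEven) (t : S) : M.ArtinGroup →* Multiplicative ℤ :=
  lift (fun s => .ofAdd ((1 : Matrix S S ℤ) t s)) fun s x => by
    obtain rfl | hsx := eq_or_ne s x
    · rfl
    · exact altWord_swap_of_even _ _ (hM s x hsx)

@[simp]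
lemma exponent_of [DecidableEq S] (hM : M.IsEven) (t s : S) :
    exponent hM t (of s) = .ofAdd ((1 : Matrix S S ℤ) t s) :=
  lift_of _ _ s

/-- The matrix of the map that a homomorphism of even Artin groups induces on abelianizations. -/
def exponentMatrix [DecidableEq T] (hN : N.IsEven) (f : M.ArtinGroup →* N.ArtinGroup) :
    Matrix T S ℤ :=
  fun t s => (exponent hN t (f (of s))).toAdd

lemma exponent_map [DecidableEq S] [DecidableEq T] [Fintype S] (hM : M.IsEven) (hN : N.IsEven)
    (f : M.ArtinGroup →* N.ArtinGroup) (t : T) (g : M.ArtinGroup) :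
    (exponent hN t (f g)).toAdd = ∑ s, exponentMatrix hN f t s * (exponent hM s g).toAdd := by
  have hcomp : (exponent hN t).comp f = ∏ s, exponent hM s ^ exponentMatrix hN f t s := by
    ext s
    simp [exponentMatrix, Matrix.one_apply]
  simpa using congrArg Multiplicative.toAdd (DFunLike.congr_fun hcomp g)

lemma exponentMatrix_mul_eq_one [DecidableEq S] [DecidableEq T] [Fintype S] (hM : M.IsEven)
    (hN : N.IsEven) {f : M.ArtinGroup →* N.ArtinGroup} {g : N.ArtinGroup →* M.ArtinGroup}
    (hfg : ∀ x, f (g x) = x) : exponentMatrix hN f * exponentMatrix hM g = 1 := by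
  ext t t'
  calc
    _ = (exponent hN t (f (g (of t')))).toAdd := by
      rw [exponent_map hM, Matrix.mul_apply]
      rfl
    _ = (1 : Matrix T T ℤ) t t' := by rw [hfg, exponent_of, toAdd_ofAdd]

/-- The homomorphism to the Heisenberg group over `ℤ/k` that sends `t` and `y` to the two
elementary generators and every other generator to `1`. -/
def toHeisenberg [DecidableEq S] (hM : M.IsEven) {t y : S} {k : ℕ} (hk : M t y = 2 * k) :
    M.ArtinGroup →* Heisenberg (ZMod k) :=
  lift (fun s => ⟨(1 : Matrix S S (ZMod k)) t s, (1 : Matrix S S (ZMod k)) y s, 0⟩) fun s x => by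
    rcases eq_or_ne s x with rfl | hsx
    · rfl
    obtain ⟨l, hl⟩ := (hM s x hsx).two_dvd
    rw [hl, Heisenberg.altWord_swap_iff]
    change (l : ZMod k) * minor₂ 1 t y s x = 0
    by_cases h : s(t, y) = s(s, x)
    · have hMM : M t y = M s x := by
        rcases Sym2.eq_iff.1 h with ⟨rfl, rfl⟩ | ⟨rfl, rfl⟩
        · rfl
        · exact M.symmetric _ _
      obtain rfl : l = k := by lia
      rw [ZMod.natCast_self, zero_mul]
    · rw [minor₂_one_eq_zero h, mul_zero]

section

variable [DecidableEq S] (hM : M.IsEven) {t y : S} {k : ℕ} (hk : M t y = 2 * k) (g : M.ArtinGroup)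

lemma toHeisenberg_x : (toHeisenberg hM hk g).x = ((exponent hM t g).toAdd : ZMod k) := by
  have hcomp : Heisenberg.xHom.comp (toHeisenberg hM hk) =
      (AddMonoidHom.toMultiplicative (Int.castAddHom (ZMod k))).comp (exponent hM t) := by
    ext s
    simp [Heisenberg.xHom, toHeisenberg, Matrix.one_apply]
  exact congrArg Multiplicative.toAdd (DFunLike.congr_fun hcomp g)

lemma toHeisenberg_y : (toHeisenberg hM hk g).y = ((exponent hM y g).toAdd : ZMod k) := by
  have hcomp : Heisenberg.yHom.comp (toHeisenberg hM hk) =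
      (AddMonoidHom.toMultiplicative (Int.castAddHom (ZMod k))).comp (exponent hM y) := by
    ext s
    simp [Heisenberg.yHom, toHeisenberg, Matrix.one_apply]
  exact congrArg Multiplicative.toAdd (DFunLike.congr_fun hcomp g)

end

theorem label_dvd_label_mul_minor₂ [DecidableEq T] (hM : M.IsEven) (hN : N.IsEven)
    (f : M.ArtinGroup →* N.ArtinGroup) {t y : T} (hty : t ≠ y) {s x : S} (hsx : s ≠ x) :
    (N t y : ℤ) ∣ M s x * minor₂ (exponentMatrix hN f) t y s x := by
  obtain ⟨k, hk⟩ := (hN t y hty).two_dvd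
  obtain ⟨l, hl⟩ := (hM s x hsx).two_dvd
  have hrel := congrArg (fun g => toHeisenberg hN hk (f g)) (altWord_of M s x)
  simp only [map_altWord] at hrel
  rw [hl, Heisenberg.altWord_swap_iff] at hrel
  simp only [toHeisenberg_x, toHeisenberg_y] at hrel
  have hdvd : (k : ℤ) ∣ l * minor₂ (exponentMatrix hN f) t y s x := by
    rw [← ZMod.intCast_zmod_eq_zero_iff_dvd]
    simp only [minor₂]
    exact_mod_cast hrel
  rw [hk, hl]
  push_cast
  rw [mul_assoc]
  exact mul_dvd_mul_left 2 hdvd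

/-- The `p`-adic valuations of the entries of a Coxeter matrix, as edge labels. The valuation of
the entry `∞`, encoded by `0`, is `⊤`. -/
noncomputable def labelValuation (p : ℕ) (M : CoxeterMatrix S) : Sym2 S → ℕ∞ :=
  Sym2.lift ⟨fun s t => emultiplicity p (M s t), fun s t => by simp only [M.symmetric s t]⟩

lemma labelCompatible_exponentMatrix [DecidableEq T] {p : ℕ} (hp : p.Prime) (hM : M.IsEven)
    (hN : N.IsEven) (f : M.ArtinGroup →* N.ArtinGroup) :
    LabelCompatible (labelValuation p N) (labelValuation p M)
      ((exponentMatrix hN f).map (Int.castRingHom (ZMod p))) := by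
  intro t y s x hminor
  have hdvd := label_dvd_label_mul_minor₂ hM hN f (rows_ne_of_minor₂_ne_zero hminor)
    (columns_ne_of_minor₂_ne_zero hminor)
  rw [minor₂_map, eq_intCast, Ne, ZMod.intCast_zmod_eq_zero_iff_dvd] at hminor
  calc
    emultiplicity p (N t y) = emultiplicity (p : ℤ) (N t y) := (Int.natCast_emultiplicity _ _).symm
    _ ≤ emultiplicity (p : ℤ) (M s x * minor₂ (exponentMatrix hN f) t y s x) :=
      emultiplicity_le_emultiplicity_of_dvd_right hdvd
    _ = emultiplicity (p : ℤ) (M s x) := by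
      rw [emultiplicity_mul (Nat.prime_iff_prime_int.1 hp), emultiplicity_eq_zero.2 hminor,
        add_zero]
    _ = emultiplicity p (M s x) := Int.natCast_emultiplicity _ _

theorem exists_equiv_emultiplicity_eq [Finite S] [Finite T] {p : ℕ} (hp : p.Prime)
    (hM : M.IsEven) (hN : N.IsEven) (φ : M.ArtinGroup ≃* N.ArtinGroup) :
    ∃ e : S ≃ T, ∀ s t, emultiplicity p (N (e s) (e t)) = emultiplicity p (M s t) := by
  classical
  have := Fintype.ofFinite S
  have := Fintype.ofFinite T
  have : Fact p.Prime := ⟨hp⟩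
  obtain ⟨e, he⟩ := exists_equiv_label_eq
    (map_mul_map_eq_one (exponentMatrix_mul_eq_one hM hN (f := φ.toMonoidHom)
      (g := φ.symm.toMonoidHom) φ.apply_symm_apply) _)
    (map_mul_map_eq_one (exponentMatrix_mul_eq_one hN hM (f := φ.symm.toMonoidHom)
      (g := φ.toMonoidHom) φ.symm_apply_apply) _)
    (labelCompatible_exponentMatrix hp hM hN φ.toMonoidHom)
    (labelCompatible_exponentMatrix hp hN hM φ.symm.toMonoidHom)
  refine ⟨e, fun s t => ?_⟩
  obtain rfl | hst := eq_or_ne s t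
  · rw [N.diagonal, M.diagonal]
  · exact he s t hst

end ArtinGroup

/-! ### Rigidity -/

theorem corollary5p2_general {S : Type u} {T : Type v} [Finite S] [Finite T] {M : CoxeterMatrix S}
    {N : CoxeterMatrix T} (hM : M.IsEven) (hN : N.IsEven) {p : ℕ} (hp : p.Prime) {L : Set ℕ}
    (hL : L.InjOn (emultiplicity p)) (hML : ∀ s t, s ≠ t → M s t ∈ L)
    (hNL : ∀ s t, s ≠ t → N s t ∈ L) :
    Nonempty (M.ArtinGroup ≃* N.ArtinGroup) ↔ M.Iso N := by
  refine ⟨?_, ArtinGroup.nonempty_mulEquiv_of_iso⟩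
  rintro ⟨φ⟩
  obtain ⟨e, he⟩ := ArtinGroup.exists_equiv_emultiplicity_eq hp hM hN φ
  refine ⟨e, fun s t => ?_⟩
  obtain rfl | hst := eq_or_ne s t
  · rw [N.diagonal, M.diagonal]
  · exact hL (hNL _ _ (e.injective.ne hst)) (hML s t hst) (he s t)

/-- The labels `{∞} ∪ {2 d^r | r ≥ 0}` allowed in `𝓔(1, d)`, with `∞` encoded by `0`. -/
def powerLabels (d : ℕ) : Set ℕ :=
  insert 0 (Set.range fun r => 2 * d ^ r)

lemma mem_powerLabels_of_evenFamily {S : Type*} {d : ℕ} {M : CoxeterMatrix S}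
    (hM : CoxeterMatrix.EvenFamily 1 d S M) (s t : S) (hst : s ≠ t) : M s t ∈ powerLabels d := by
  rcases hM.2 s t hst with h | h | ⟨r, -, h⟩
  · exact .inr ⟨0, by simp only [h, pow_zero]⟩
  · exact .inl h
  · exact .inr ⟨r, h.symm⟩

lemma injOn_emultiplicity_powerLabels {p d : ℕ} (hp : p.Prime) (hpd : p ∣ d) (hd : d ≠ 0) :
    (powerLabels d).InjOn (emultiplicity p) := by
  have finite_label (r : ℕ) : emultiplicity p (2 * d ^ r) ≠ ⊤ :=
    finiteMultiplicity_iff_emultiplicity_ne_top.1 <|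
      Nat.finiteMultiplicity_iff.2 ⟨hp.ne_one, by positivity⟩
  have strictMono_label : StrictMono fun r => emultiplicity p (2 * d ^ r) := by
    refine strictMono_nat_of_lt_succ fun r => ?_
    rw [pow_succ', mul_left_comm, emultiplicity_mul hp.prime (a := d)]
    exact ENat.lt_add_left (finite_label r) (pos_iff_ne_zero.2 (emultiplicity_ne_zero.2 hpd))
  refine (Set.injOn_insert ?_).2 ⟨?_, ?_⟩
  · rintro ⟨r, hr⟩
    exact mul_ne_zero two_ne_zero (pow_ne_zero r hd) hr
  · rintro _ ⟨r, rfl⟩ _ ⟨k, rfl⟩ h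
    rw [strictMono_label.injective h]
  · rintro ⟨_, ⟨r, rfl⟩, h⟩
    exact finite_label r (h.trans (emultiplicity_zero p))

theorem corollary5p2 (d : ℕ) (hd : 2 ≤ d) :
    CoxeterMatrix.ArtinRigid.{u} (CoxeterMatrix.EvenFamily.{u} 1 d) :=
  fun _ _ _ _ _ _ hM hN => corollary5p2_general hM.1 hN.1 (Nat.minFac_prime (by lia))
    (injOn_emultiplicity_powerLabels (Nat.minFac_prime (by lia)) d.minFac_dvd (by lia))
    (mem_powerLabels_of_evenFamily hM) (mem_powerLabels_of_evenFamily hN)
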